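/- Let $V$ be a commutative unital quantale: a complete lattice with a commutative, associative tensor product $\otimes$ with unit $k$ that preserves suprema in each variable, so that $u\otimes v\le w\iff v\le\hom(u,w)$. Assume $k\neq\bot$ and that $V$ is constructively completely distributive, i.e. $\bigvee$, as a map from the down-closed subsets of $V$ ordered by inclusion to $V$, has a left adjoint. A $V$-matrix $r:X⇸Y$ is a map $r:X\times Y\to V$; matrices are ordered pointwise and composed by $(s\cdot r)(x,z)=\bigvee_y r(x,y)\otimes s(y,z)$; $r^\circ$ is the transpose; a map $f$ is identified with the matrix which is $k$ at $(x,f(x))$ and $\bot$ elsewhere. Let $\mathbb T=(T,e,m)$ be a monad on $\mathbf{Set}$ which is not one of the two trivial monads ($TX=1$ for all $X$; or $T\varnothing=\varnothing$ and $TX=1$ for all $X\ne\varnothing$). Assume that $T$ sends pullbacks to weak pullbacks, that every naturality square of $m$ is a weak pullback, and that $k=\top$ or $T\varnothing=\varnothing$. For a relation $R\subseteq X\times Y$ with projections $q:R\to X$, $p:R\to Y$, let $TR$ be the relation with $TR(\mathfrak x,\mathfrak y)$ iff $Tq(\mathfrak w)=\mathfrak x$ and $Tp(\mathfrak w)=\mathfrak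 y$ for some $\mathfrak w\in T(R)$. Extend $T$ to $V$-matrices $r:X⇸Y$ by $$Tr(\mathfrak x,\mathfrak y)=\bigvee\{v\in V\mid T(r_v)(\mathfrak x,\mathfrak y)\},\qquad r_v=\{(x,y)\mid v\le r(x,y)\}.$$ Let $\xi:TV\to V$, $\xi(\mathfrak v)=\bigvee\{v\in V\mid \mathfrak v\in T(\uparrow v)\}$, where $\uparrow v=\{u\mid v\le u\}$ and $T(\uparrow v)$ is regarded as a subset of $TV$. Assume $\xi(T\pi_1(\mathfrak w))\otimes\xi(T\pi_2(\mathfrak w))=\xi(T(\otimes)(\mathfrak w))$ for all $\mathfrak w\in T(V\times V)$. A $(\mathbb T,V)$-category is a set $X$ with a matrix $a:TX⇸X$ such that $k\le a(e_X(x),x)$ and $Ta(\mathfrak X,\mathfrak x)\otimes a(\mathfrak x,x)\le a(m_X(\mathfrak X),x)$ for all $\mathfrak X\in TTX$, $\mathfrak x\in TX$, $x\in X$. A $(\mathbb T,V)$-functor $f:(X,a)\to(Y,b)$ is a map $f:X\to Y$ with $a(\mathfrak x,x)\le b(Tf(\mathfrak x),f(x))$ for all $\mathfrak x\in TX$, $x\in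 X$. The Kleisli composite of $a:TX⇸Y$ and $b:TY⇸Z$ is $b*a=b\cdot Ta\cdot m_X^\circ$. A $(\mathbb T,V)$-bimodule $\psi:(X,a)\to(Y,b)$ is a matrix $\psi:TX⇸Y$ with $\psi*a\le\psi$ and $b*\psi\le\psi$. For a $(\mathbb T,V)$-category $X=(X,a)$ let $|X|=(TX,m_X)$ and $X^{\mathrm{op}}=(TX,\;e_{TX}^\circ\cdot T((Ta\cdot m_X^\circ)^\circ))$. Let $(X,a)\otimes(Y,b)=(X\times Y,a\otimes b)$ with $(a\otimes b)(\mathfrak w,(x,y))=a(T\pi_X(\mathfrak w),x)\otimes b(T\pi_Y(\mathfrak w),y)$. Let $V$ carry the structure $\hom_\xi(\mathfrak v,v)=\hom(\xi(\mathfrak v),v)$. **Theorem.** Assume that $m$ is a (strict) natural transformation for the extension of $T$ to $V$-matrices, i.e. $m_Y\cdot TTr=Tr\cdot m_X$ for every $V$-matrix $r:X⇸Y$. Let $(X,a)$ and $(Y,b)$ be $(\mathbb T,V)$-categories and let $\psi:TX⇸Y$ be a $V$-matrix. The following are equivalent: (i) $\psi:(X,a)\to(Y,b)$ is a $(\mathbb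 T,V)$-bimodule; (ii) both $\psi:|X|\otimes Y\to V$ and $\psi:X^{\mathrm{op}}\otimes Y\to V$ are $(\mathbb T,V)$-functors. -/

import Mathlib

open CategoryTheory

universe u

namespace TVCat

noncomputable section

/-! ### Matrices with values in a commutative unital quantale

The quantale is a type `V` with `[CompleteLattice V] [CommMonoid V] [IsQuantale V]`: the tensor
product is `*`, its unit `k` is `1`, and `hom u w = Quantale.rightMulResiduation u w` is the
right adjoint, `v ≤ hom u w ↔ u * v ≤ w`. -/

section Matrices

variable {V : Type u} [CompleteLattice V] [CommMonoid V] [IsQuantale V]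

/-- Constructive complete distributivity: the map `⋁` from down-closed subsets of `V` (ordered by
inclusion) to `V` has a left adjoint. -/
def IsCCD (V : Type u) [CompleteLattice V] : Prop :=
  ∃ l : V → LowerSet V, GaloisConnection l (fun S : LowerSet V => sSup (S : Set V))

/-- A `V`-matrix `X ⇸ Y`. Matrices are ordered pointwise. -/
abbrev VMat (V : Type u) (X Y : Type u) : Type u := X → Y → V

/-- Composition `s · r` of matrices. -/
def comp {X Y Z : Type u} (s : VMat V Y Z) (r : VMat V X Y) : VMat V X Z :=
  fun x z => ⨆ y, r x y * s y z

/-- The transpose `r°`. -/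
def transpose {X Y : Type u} (r : VMat V X Y) : VMat V Y X :=
  fun y x => r x y

open Classical in
/-- The matrix of a map. -/
def ofMap (V : Type u) [CompleteLattice V] [CommMonoid V] {X Y : Type u} (f : X → Y) :
    VMat V X Y :=
  fun x y => if f x = y then 1 else ⊥

end Matrices

/-! ### Monads on sets -/

section Monads

variable (T : CategoryTheory.Monad (Type u))

/-- The action `T₀ f` of the functor on a map. -/
def tmap {X Y : Type u} (f : X → Y) : T.obj X → T.obj Y := T.map (↾f)

/-- The unit `e_X : X → T X`. -/
def unit (X : Type u) : X → T.obj X := T.η.app X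

/-- The multiplication `m_X : T T X → T X`. -/
def mult (X : Type u) : T.obj (T.obj X) → T.obj X := T.μ.app X

/-- The two trivial monads: `T X = 1` for all `X`, or `T ∅ = ∅` and `T X = 1` for all
non-empty `X`. -/
def IsTrivial : Prop :=
  (∀ X : Type u, Nonempty (Unique (T.obj X))) ∨
    ((∀ X : Type u, IsEmpty X → IsEmpty (T.obj X)) ∧
      ∀ X : Type u, Nonempty X → Nonempty (Unique (T.obj X)))

/-- A commutative square of sets which is a weak pullback. -/
def IsWeakPullback {P X Y Z : Type u} (p : P → X) (q : P → Y) (f : X → Z) (g : Y → Z) : Prop :=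
  (∀ w, f (p w) = g (q w)) ∧ ∀ x y, f x = g y → ∃ w, p w = x ∧ q w = y

/-- The functor `T` satisfies (BC): it sends pullbacks to weak pullbacks. -/
def FunctorBC : Prop :=
  ∀ (P X Y Z : Type u) (p : P → X) (q : P → Y) (f : X → Z) (g : Y → Z),
    IsPullback (↾p) (↾q) (↾f) (↾g) →
      IsWeakPullback (tmap T p) (tmap T q) (tmap T f) (tmap T g)

/-- The natural transformation `m` satisfies (BC): each naturality square is a weak pullback. -/
def MultBC : Prop :=
  ∀ (X Y : Type u) (f : X → Y),
    IsWeakPullback (mult T X) (tmap T (tmap T f)) (tmap T f) (mult T Y)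

/-- The Barr extension of `T` to relations: `T R = T p · (T q)°`, where `q`, `p` are the
projections of the graph of `R` to `X` and `Y`. -/
def relExt {X Y : Type u} (R : X → Y → Prop) (x : T.obj X) (y : T.obj Y) : Prop :=
  ∃ w : T.obj {z : X × Y // R z.1 z.2},
    tmap T (fun z => z.1.1) w = x ∧ tmap T (fun z => z.1.2) w = y

end Monads

/-! ### The extension of a monad to matrices, and `(T,V)`-categories -/

section Extension

variable {V : Type u} [CompleteLattice V] [CommMonoid V] [IsQuantale V]
variable (T : CategoryTheory.Monad (Type u))

/-- The extension of `T` to matrices: `T r (x, y) = ⋁ {v | T(r_v) (x, y)}`, where `r_v` is the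
relation `v ≤ r`. -/
def ext {X Y : Type u} (r : VMat V X Y) : VMat V (T.obj X) (T.obj Y) :=
  fun x y => sSup {v : V | relExt T (fun a b => v ≤ r a b) x y}

/-- `m` is a (strict) natural transformation for the extension of `T` to matrices:
`m_Y · T T r = T r · m_X`. -/
def MultStrictNatural (V : Type u) [CompleteLattice V] [CommMonoid V] [IsQuantale V]
    (T : CategoryTheory.Monad (Type u)) : Prop :=
  ∀ (X Y : Type u) (r : VMat V X Y),
    comp (ofMap V (mult T Y)) (ext T (ext T r)) = comp (ext T r) (ofMap V (mult T X))

/-- The map `ξ : T V → V`, `ξ x = ⋁ {v | x ∈ T (↑v)}`, where `T (↑v)` is the image of `T` of the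
inclusion of `↑v = {u | v ≤ u}`. -/
def xi (x : T.obj V) : V :=
  sSup {v : V | x ∈ Set.range (tmap T (Subtype.val : {u : V // v ≤ u} → V))}

/-- `⊗ · ⟨ξ · T π₁, ξ · T π₂⟩ = ξ · T (⊗)` on `T (V × V)`. -/
def XiTensor (V : Type u) [CompleteLattice V] [CommMonoid V] [IsQuantale V]
    (T : CategoryTheory.Monad (Type u)) : Prop :=
  ∀ w : T.obj (V × V),
    xi T (tmap T Prod.fst w) * xi T (tmap T Prod.snd w)
      = xi T (tmap T (fun p : V × V => p.1 * p.2) w)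

/-- `(X, a)` is a `(T,V)`-category. -/
structure IsTVCategory {X : Type u} (a : VMat V (T.obj X) X) : Prop where
  refl : ∀ x : X, 1 ≤ a (unit T X x) x
  trans : ∀ (A : T.obj (T.obj X)) (y : T.obj X) (x : X),
    ext T a A y * a y x ≤ a (mult T X A) x

/-- `f : (X, a) → (Y, b)` is a `(T,V)`-functor. -/
def IsTVFunctor {X Y : Type u} (a : VMat V (T.obj X) X) (b : VMat V (T.obj Y) Y)
    (f : X → Y) : Prop :=
  ∀ (y : T.obj X) (x : X), a y x ≤ b (tmap T f y) (f x)

/-- Kleisli composition `s ∗ r = s · T r · m_X°`. -/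
def kleisli {X Y Z : Type u} (s : VMat V (T.obj Y) Z) (r : VMat V (T.obj X) Y) :
    VMat V (T.obj X) Z :=
  comp s (comp (ext T r) (transpose (ofMap V (mult T X))))

/-- `ψ : (X, a) ⇸ (Y, b)` is a `(T,V)`-bimodule. -/
structure IsTVBimodule {X Y : Type u} (a : VMat V (T.obj X) X) (b : VMat V (T.obj Y) Y)
    (ψ : VMat V (T.obj X) Y) : Prop where
  right : kleisli T ψ a ≤ ψ
  left : kleisli T b ψ ≤ ψ

/-- The structure of `|X| = (T X, m_X)`. -/
def freeStr (V : Type u) [CompleteLattice V] [CommMonoid V]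
    (T : CategoryTheory.Monad (Type u)) (X : Type u) : VMat V (T.obj (T.obj X)) (T.obj X) :=
  ofMap V (mult T X)

/-- `M°` sends a `(T,V)`-category `(X, a)` to the `V`-category `(T X, T a · m_X°)`. -/
def mCirc {X : Type u} (a : VMat V (T.obj X) X) : VMat V (T.obj X) (T.obj X) :=
  comp (ext T a) (transpose (ofMap V (mult T X)))

/-- `E°` sends a `V`-category `(X, a)` to the `(T,V)`-category `(X, e_X° · T a)`. -/
def eCirc {X : Type u} (a : VMat V X X) : VMat V (T.obj X) X :=
  comp (transpose (ofMap V (unit T X))) (ext T a)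

/-- The structure of the dual `X^op = E°(M°(X)^op)`, whose underlying set is `T X`. -/
def opStr {X : Type u} (a : VMat V (T.obj X) X) : VMat V (T.obj (T.obj X)) (T.obj X) :=
  eCirc T (transpose (mCirc T a))

/-- The structure `a ⊗ b` of the tensor product on `X × Y`. -/
def tensorStr {X Y : Type u} (a : VMat V (T.obj X) X) (b : VMat V (T.obj Y) Y) :
    VMat V (T.obj (X × Y)) (X × Y) :=
  fun w p => a (tmap T Prod.fst w) p.1 * b (tmap T Prod.snd w) p.2

/-- The structure `hom_ξ = hom · ξ` on `V`. -/
def homXi (V : Type u) [CompleteLattice V] [CommMonoid V] [IsQuantale V]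
    (T : CategoryTheory.Monad (Type u)) : VMat V (T.obj V) V :=
  fun x v => Quantale.rightMulResiduation (xi T x) v

end Extension

end

end TVCat

namespace TVCat

/-! ### Barr extension to relations -/

section SetMonads

variable (T : CategoryTheory.Monad (Type u))

/-! Since `T` sends pullbacks to weak pullbacks, `ext T r x y` is the supremum of `ξ (T r w)` over
all `w` projecting to `x` and `y`. By residuation, functoriality of `ψ` on a tensor product becomes
the inequality `ext T ψ A z * (c A x * b z y) ≤ ψ x y`, where `c` is the structure on the first
factor. For `c = m_X` this says exactly that `b` acts on `ψ`. For `c` the dual structure, `c A x` is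
`ext T (mCirc T a)` at `(e x, A)`. Lax functoriality of the extension and the action of `a` bound
the product by `ext T ψ (e x) z * b z y`, and the action of `b` gives `ψ x y` because `m (e x) = x`.
Conversely, evaluating at units recovers the action of `a`. -/

theorem tmap_tmap {X Y Z : Type u} (f : X → Y) (g : Y → Z) (w : T.obj X) :
    tmap T g (tmap T f w) = tmap T (fun x => g (f x)) w := by
  have h : T.map (↾fun x => g (f x)) = T.map (↾f) ≫ T.map (↾g) := by
    rw [← T.map_comp]; rfl
  simp only [tmap, h, types_comp_apply]

theorem tmap_unit {X Y : Type u} (f : X → Y) (x : X) :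
    tmap T f (unit T X x) = unit T Y (f x) :=
  (ConcreteCategory.congr_hom (T.η.naturality (↾f)) x).symm

theorem mult_unit {X : Type u} (x : T.obj X) : mult T X (unit T (T.obj X) x) = x :=
  ConcreteCategory.congr_hom (T.left_unit X) x

theorem FunctorBC.exists_preimage {T : CategoryTheory.Monad (Type u)} (hT : FunctorBC T)
    {P X Y Z : Type u} {p : P → X} {q : P → Y} {f : X → Z} {g : Y → Z}
    (hw : ∀ w, f (p w) = g (q w)) (hinj : ∀ w w', p w = p w' → q w = q w' → w = w')
    (hsurj : ∀ x y, f x = g y → ∃ w, p w = x ∧ q w = y)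
    {x : T.obj X} {y : T.obj Y} (h : tmap T f x = tmap T g y) :
    ∃ w, tmap T p w = x ∧ tmap T q w = y := by
  refine (hT P X Y Z p q f g ?_).2 x y h
  rw [Limits.Types.isPullback_iff]
  refine ⟨?_, fun w w' h => hinj w w' h.1 h.2, hsurj⟩
  ext w
  exact hw w

theorem relExt_swap {X Y : Type u} {R : X → Y → Prop} {x : T.obj X} {y : T.obj Y}
    (h : relExt T R x y) : relExt T (fun b a => R a b) y x := by
  obtain ⟨w, rfl, rfl⟩ := h
  exact ⟨tmap T (fun z => ⟨(z.1.2, z.1.1), z.2⟩) w, tmap_tmap .., tmap_tmap ..⟩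

theorem relExt_mono {X Y : Type u} {R S : X → Y → Prop} (hRS : ∀ x y, R x y → S x y)
    {x : T.obj X} {y : T.obj Y} (h : relExt T R x y) : relExt T S x y := by
  obtain ⟨w, rfl, rfl⟩ := h
  exact ⟨tmap T (fun z => ⟨z.1, hRS _ _ z.2⟩) w, tmap_tmap .., tmap_tmap ..⟩

theorem relExt_unit {X Y : Type u} {R : X → Y → Prop} {x : X} {y : Y} (h : R x y) :
    relExt T R (unit T X x) (unit T Y y) :=
  ⟨unit T _ ⟨(x, y), h⟩, tmap_unit .., tmap_unit ..⟩

variable {T}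

/-- The two witnesses agree in `T Y`, so they lift to `T` of the pullback of the two graphs over
`Y`, which maps to the graph of the composite. -/
theorem relExt_comp (hT : FunctorBC T) {X Y Z : Type u} {R : X → Y → Prop} {S : Y → Z → Prop}
    {x : T.obj X} {y : T.obj Y} {z : T.obj Z} (hR : relExt T R x y) (hS : relExt T S y z) :
    relExt T (fun x z => ∃ y, R x y ∧ S y z) x z := by
  obtain ⟨u, rfl, rfl⟩ := hR
  obtain ⟨v, hv, rfl⟩ := hS
  obtain ⟨w, rfl, rfl⟩ := hT.exists_preimage
    (P := {p : {z : X × Y // R z.1 z.2} × {z : Y × Z // S z.1 z.2} // p.1.1.2 = p.2.1.1})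
    (p := fun p => p.1.1) (q := fun p => p.1.2)
    (fun w => w.2) (fun w w' h h' => Subtype.ext (Prod.ext h h'))
    (fun a b h => ⟨⟨(a, b), h⟩, rfl, rfl⟩) hv.symm
  refine ⟨tmap T (fun p => ⟨(p.1.1.1.1, p.1.2.1.2), p.1.1.1.2, p.1.1.2, ?_⟩) w, ?_, ?_⟩
  · have h := p.1.2.2
    rwa [← p.2] at h
  · rw [tmap_tmap, tmap_tmap]
  · rw [tmap_tmap, tmap_tmap]

/-- The extension of the relation `{(x, y) | P (f x y)}` consists of the pairs of projections of
elements of `T (X × Y)` which `T f` sends into `T P`. -/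
theorem relExt_iff_exists_mem_range (hT : FunctorBC T) {X Y W : Type u} (f : X → Y → W)
    (P : W → Prop) {x : T.obj X} {y : T.obj Y} :
    relExt T (fun a b => P (f a b)) x y ↔
      ∃ w : T.obj (X × Y), tmap T Prod.fst w = x ∧ tmap T Prod.snd w = y ∧
        tmap T (fun p : X × Y => f p.1 p.2) w ∈
          Set.range (tmap T (Subtype.val : {u : W // P u} → W)) := by
  constructor
  · rintro ⟨w, rfl, rfl⟩
    refine ⟨tmap T Subtype.val w, tmap_tmap .., tmap_tmap ..,
      tmap T (fun z => ⟨f z.1.1 z.1.2, z.2⟩) w, ?_⟩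
    rw [tmap_tmap, tmap_tmap]
  · rintro ⟨w, rfl, rfl, t, ht⟩
    -- The preimage of `P` under `f` is a pullback, so `w` lifts to `T` of it.
    obtain ⟨w', rfl, -⟩ := hT.exists_preimage
      (P := {z : X × Y // P (f z.1 z.2)}) (p := Subtype.val)
      (q := fun z => (⟨f z.1.1 z.1.2, z.2⟩ : {u : W // P u}))
      (fun _ => rfl) (fun w w' h _ => Subtype.ext h)
      (fun a b h => ⟨⟨a, by rw [h]; exact b.2⟩, rfl, Subtype.ext h⟩) ht.symm
    exact ⟨w', (tmap_tmap ..).symm, (tmap_tmap ..).symm⟩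

end SetMonads

/-! ### Extension to matrices -/

section MatrixExtension

variable {V : Type u} [CompleteLattice V] (T : CategoryTheory.Monad (Type u))

theorem ext_transpose_le {X Y : Type u} (r : VMat V X Y) (x : T.obj X) (y : T.obj Y) :
    ext T r x y ≤ ext T (transpose r) y x :=
  sSup_le_sSup fun _ h => Set.mem_ofPred.2 (relExt_swap T (Set.mem_ofPred.1 h))

theorem ext_transpose {X Y : Type u} (r : VMat V X Y) :
    ext T (transpose r) = transpose (ext T r) :=
  funext fun y => funext fun x =>
    le_antisymm (ext_transpose_le T (transpose r) y x) (ext_transpose_le T r x y)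

theorem ext_mono {X Y : Type u} {r s : VMat V X Y} (h : r ≤ s) : ext T r ≤ ext T s :=
  fun _ _ => sSup_le_sSup fun _ hv =>
    Set.mem_ofPred.2 (relExt_mono T (fun a b hab => le_trans hab (h a b)) (Set.mem_ofPred.1 hv))

theorem le_ext_unit {X Y : Type u} (r : VMat V X Y) (x : X) (y : Y) :
    r x y ≤ ext T r (unit T X x) (unit T Y y) :=
  le_sSup (Set.mem_ofPred.2 (relExt_unit T (R := fun a b => r x y ≤ r a b) le_rfl))

end MatrixExtension

/-! ### Bimodules as functors into `V` -/

section Bimodules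

variable {V : Type u} [CompleteLattice V] [CommMonoid V] [IsQuantale V]
variable {T : CategoryTheory.Monad (Type u)}

/-- The tensor preserves suprema, so it suffices to compose the level relations at `u` and `v`; the
composite lies in the level relation at `u * v`. -/
theorem ext_mul_ext_le (hT : FunctorBC T) {X Y Z : Type u} (r : VMat V X Y) (s : VMat V Y Z)
    (x : T.obj X) (y : T.obj Y) (z : T.obj Z) :
    ext T r x y * ext T s y z ≤ ext T (comp s r) x z := by
  rw [ext, sSup_mul_distrib]
  refine iSup₂_le fun u hu => ?_
  rw [ext, mul_sSup_distrib]
  refine iSup₂_le fun v hv => le_sSup (Set.mem_ofPred.2 ?_)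
  refine relExt_mono T ?_ (relExt_comp hT (Set.mem_ofPred.1 hu) (Set.mem_ofPred.1 hv))
  rintro a c ⟨b, hab, hbc⟩
  exact (mul_le_mul' hab hbc).trans (le_iSup (fun b => r a b * s b c) b)

theorem ext_mul_le_iff (hT : FunctorBC T) {X Y : Type u} (r : VMat V X Y) (x : T.obj X)
    (y : T.obj Y) (c d : V) :
    ext T r x y * c ≤ d ↔
      ∀ w : T.obj (X × Y), tmap T Prod.fst w = x → tmap T Prod.snd w = y →
        xi T (tmap T (fun p : X × Y => r p.1 p.2) w) * c ≤ d := by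
  simp only [ext, xi, sSup_mul_distrib, iSup_le_iff, Set.mem_ofPred_eq]
  constructor
  · intro h w hx hy v hv
    exact h v ((relExt_iff_exists_mem_range hT r (v ≤ ·)).2 ⟨w, hx, hy, hv⟩)
  · intro h v hv
    obtain ⟨w, hx, hy, hw⟩ := (relExt_iff_exists_mem_range hT r (v ≤ ·)).1 hv
    exact h w hx hy v hw

theorem comp_transpose_ofMap_apply {X Y Z : Type u} (f : X → Y) (r : VMat V X Z) (y : Y) (z : Z) :
    comp r (transpose (ofMap V f)) y z = ⨆ x : {x // f x = y}, r x z := by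
  rw [iSup_subtype]
  refine iSup_congr fun x => ?_
  by_cases h : f x = y <;> simp [transpose, ofMap, h]

/-- The extension commutes with transposition, and composing with `e°` evaluates at a unit. -/
theorem opStr_apply {X : Type u} (a : VMat V (T.obj X) X) (A : T.obj (T.obj X)) (x : T.obj X) :
    opStr T a A x = ext T (mCirc T a) (unit T (T.obj X) x) A := by
  rw [opStr, eCirc, ext_transpose]
  refine le_antisymm (iSup_le fun z => ?_) (le_iSup_of_le (unit T (T.obj X) x) ?_)
  · by_cases h : unit T (T.obj X) x = z <;> simp [transpose, ofMap, h]
  · simp [transpose, ofMap]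

theorem kleisli_le_iff {X Y Z : Type u} (s : VMat V (T.obj Y) Z) (r : VMat V (T.obj X) Y)
    (t : VMat V (T.obj X) Z) :
    kleisli T s r ≤ t ↔
      ∀ (A : T.obj (T.obj X)) (y : T.obj Y) (z : Z),
        ext T r A y * s y z ≤ t (mult T X A) z := by
  constructor
  · intro h A y z
    refine le_trans ?_ (h (mult T X A) z)
    refine le_iSup_of_le y ?_
    rw [comp_transpose_ofMap_apply]
    exact mul_le_mul_left (le_iSup (fun B : {B // mult T X B = mult T X A} => ext T r B y) ⟨A, rfl⟩) _
  · intro h x z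
    refine iSup_le fun y => ?_
    rw [comp_transpose_ofMap_apply]
    rw [Quantale.iSup_mul_distrib]
    refine iSup_le ?_
    rintro ⟨A, rfl⟩
    exact h A y z

/-- Functors from a tensor product into `V` amount to an inequality for the extension. -/
theorem isTVFunctor_tensorStr_homXi_iff (hT : FunctorBC T) {X Y : Type u}
    (a : VMat V (T.obj X) X) (b : VMat V (T.obj Y) Y) (ψ : VMat V X Y) :
    IsTVFunctor T (tensorStr T a b) (homXi V T) (fun p : X × Y => ψ p.1 p.2) ↔
      ∀ (A : T.obj X) (z : T.obj Y) (x : X) (y : Y),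
        ext T ψ A z * (a A x * b z y) ≤ ψ x y := by
  simp only [ext_mul_le_iff hT]
  constructor
  · rintro h _ _ x y w rfl rfl
    exact Quantale.rightMulResiduation_le_iff_mul_le.1 (h w (x, y))
  · intro h w p
    exact Quantale.rightMulResiduation_le_iff_mul_le.2 (h _ _ p.1 p.2 w rfl rfl)

theorem kleisli_le_iff_isTVFunctor_freeStr (hT : FunctorBC T) {X Y : Type u}
    (b : VMat V (T.obj Y) Y) (ψ : VMat V (T.obj X) Y) :
    kleisli T b ψ ≤ ψ ↔
      IsTVFunctor T (tensorStr T (freeStr V T X) b) (homXi V T)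
        (fun p : T.obj X × Y => ψ p.1 p.2) := by
  rw [kleisli_le_iff, isTVFunctor_tensorStr_homXi_iff hT]
  constructor
  · intro h A z x y
    -- The free structure is `1` when `m A = x` and `⊥` otherwise, where the inequality is trivial.
    by_cases hx : mult T X A = x
    · subst hx
      simpa [freeStr, ofMap] using h A z y
    · simp [freeStr, ofMap, hx]
  · intro h A z y
    simpa [freeStr, ofMap] using h A z (mult T X A) y

theorem IsTVBimodule.isTVFunctor_opStr (hT : FunctorBC T) {X Y : Type u}
    {a : VMat V (T.obj X) X} {b : VMat V (T.obj Y) Y} {ψ : VMat V (T.obj X) Y}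
    (h : IsTVBimodule T a b ψ) :
    IsTVFunctor T (tensorStr T (opStr T a) b) (homXi V T)
      (fun p : T.obj X × Y => ψ p.1 p.2) := by
  refine (isTVFunctor_tensorStr_homXi_iff hT ..).2 fun A z x y => ?_
  rw [opStr_apply, ← mul_assoc, mul_comm (ext T ψ A z)]
  calc ext T (mCirc T a) (unit T (T.obj X) x) A * ext T ψ A z * b z y
      ≤ ext T (comp ψ (mCirc T a)) (unit T (T.obj X) x) z * b z y :=
        mul_le_mul_left (ext_mul_ext_le hT ..) _
    _ ≤ ext T ψ (unit T (T.obj X) x) z * b z y :=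
        mul_le_mul_left (ext_mono T h.right ..) _
    _ ≤ ψ (mult T X (unit T (T.obj X) x)) y := (kleisli_le_iff ..).1 h.left ..
    _ = ψ x y := by rw [mult_unit]

theorem kleisli_le_of_isTVFunctor_opStr (hT : FunctorBC T) {X Y : Type u}
    {a : VMat V (T.obj X) X} {b : VMat V (T.obj Y) Y} {ψ : VMat V (T.obj X) Y}
    (hb : ∀ y, 1 ≤ b (unit T Y y) y)
    (h : IsTVFunctor T (tensorStr T (opStr T a) b) (homXi V T)
      (fun p : T.obj X × Y => ψ p.1 p.2)) :
    kleisli T ψ a ≤ ψ := by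
  rw [isTVFunctor_tensorStr_homXi_iff hT] at h
  refine fun x y => iSup_le fun z => ?_
  -- At units, the extensions dominate `ψ z y` and `mCirc T a x z`, while reflexivity makes the
  -- factor from `b` at least `1`.
  have key := h (unit T (T.obj X) z) (unit T Y y) x y
  rw [opStr_apply] at key
  refine le_trans ?_ key
  calc mCirc T a x z * ψ z y = ψ z y * (mCirc T a x z * 1) := by rw [mul_one, mul_comm]
    _ ≤ _ := mul_le_mul' (le_ext_unit T ψ z y) (mul_le_mul' (le_ext_unit T _ x z) (hb y))

end Bimodules

end TVCat

theorem theorem3p3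
    (V : Type u) [CompleteLattice V] [CommMonoid V] [IsQuantale V]
    (hV : (1 : V) ≠ ⊥) (hccd : TVCat.IsCCD V)
    (T : CategoryTheory.Monad (Type u))
    (hT : ¬ TVCat.IsTrivial T)
    (hext : (1 : V) = ⊤ ∨ IsEmpty (T.obj PEmpty.{u + 1}))
    (hTBC : TVCat.FunctorBC T) (hmBC : TVCat.MultBC T)
    (hxi : TVCat.XiTensor V T)
    (hm : TVCat.MultStrictNatural V T)
    (X Y : Type u)
    (a : TVCat.VMat V (T.obj X) X) (ha : TVCat.IsTVCategory T a)
    (b : TVCat.VMat V (T.obj Y) Y) (hb : TVCat.IsTVCategory T b)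
    (ψ : TVCat.VMat V (T.obj X) Y) :
    TVCat.IsTVBimodule T a b ψ ↔
      TVCat.IsTVFunctor T (TVCat.tensorStr T (TVCat.freeStr V T X) b) (TVCat.homXi V T)
          (fun p : T.obj X × Y => ψ p.1 p.2) ∧
        TVCat.IsTVFunctor T (TVCat.tensorStr T (TVCat.opStr T a) b) (TVCat.homXi V T)
          (fun p : T.obj X × Y => ψ p.1 p.2) := by
  rw [← TVCat.kleisli_le_iff_isTVFunctor_freeStr hTBC]
  exact ⟨fun h => ⟨h.left, h.isTVFunctor_opStr hTBC⟩,
    fun h => ⟨TVCat.kleisli_le_of_isTVFunctor_opStr hTBC hb.refl h.2, h.1⟩⟩
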